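/- Let $\mathbb{H}$ be the upper half-plane, $\mathbb{D}$ the open unit disc in $\mathbb{C}$, and $\rho = e^{\pi i/3} = \frac{1+i\sqrt3}{2}$. For $\tau\in\mathbb{H}$ and $q=e^{2\pi i\tau}$ let $\Delta(\tau)=q\prod_{n\ge1}(1-q^n)^{24}$ be the modular discriminant, $j(\tau)=E_4(\tau)^3/\Delta(\tau)=q^{-1}+744+\cdots$ the $j$-invariant (with $E_4$ the Eisenstein series of weight $4$ with constant term $1$), and $$g_\infty(\tau)=-\log\bigl((4\pi\,\Im\tau)^6|\Delta(\tau)|\bigr).$$ Let $\psi\colon\mathbb{D}\to\mathbb{H}$, $\psi(w)=\frac{\overline{\rho}\,w+\rho}{w+1}$, and for $w\in\mathbb{D}$ put $$g_{\mathbb{D}}(w)=g_\infty(\psi(w)),\qquad \widehat h(w)=\frac{\Delta(\psi(w))}{(1+w)^{12}}.$$ There is a holomorphic function $f\colon\mathbb{D}\to\mathbb{C}$ (clearly unique) such that $j(\psi(w))=f(w^3)$ for every $w\in\mathbb{D}$, and $f'(0)$ is real; moreover there is a holomorphic branch of $\log\widehat h$ on $\mathbb{D}$. For every $w\in\mathbb{D}$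 with $|w|\le 1-\frac{\pi}{2\sqrt3}$, and for any such branch, $$\left|g_{\mathbb{D}}(w)-\left(g_{\mathbb{D}}(0)-6\log(1-|w|^2)-\frac{f'(0)}{13824}\Re(w^3)\right)\right|\le 6^3|w|^6,$$ $$\left|(\log\widehat h)'(w)\,w-\frac{3f'(0)}{13824}\,w^3\right|\le 6^4|w|^6,$$ $$\left|(\log\widehat h)''(w)\,w^2-\frac{6f'(0)}{13824}\,w^3\right|\le 5\cdot 6^4|w|^6.$$ -/

import Mathlib

open UpperHalfPlane

noncomputable section

namespace FaltingsApprox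

/-- The point `ρ = (1 + i√3)/2 = e^{πi/3}`. -/
def rho : ℂ := ⟨1 / 2, Real.sqrt 3 / 2⟩

/-- The Möbius map `ψ(w) = (ρ̄ w + ρ)/(w + 1)`, which sends the unit disc to the upper half-plane
and `0` to `ρ`. -/
def psi (w : ℂ) : ℂ := ((starRingEnd ℂ) rho * w + rho) / (w + 1)

theorem psi_im (w : ℂ) :
    (psi w).im = Real.sqrt 3 / 2 * ((1 - ‖w‖ ^ 2) / ‖1 + w‖ ^ 2) := by
  rw [← Complex.normSq_eq_norm_sq, ← Complex.normSq_eq_norm_sq, add_comm 1 w]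
  simp only [psi, rho, Complex.div_im, Complex.add_re, Complex.add_im, Complex.mul_re,
    Complex.mul_im, Complex.conj_re, Complex.conj_im, Complex.one_re, Complex.one_im,
    Complex.normSq_apply w]
  ring

theorem psi_im_pos {w : ℂ} (hw : w ∈ Metric.ball (0 : ℂ) 1) : 0 < (psi w).im := by
  have h1 : ‖w‖ < 1 := by simpa using hw
  have h2 : 0 < ‖1 + w‖ := by
    refine norm_pos_iff.mpr fun h => ?_
    have : w = -1 := by linear_combination h
    rw [this] at h1
    simp at h1
  have h3 : 0 < 1 - ‖w‖ ^ 2 := by nlinarith [norm_nonneg w]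
  rw [psi_im]
  positivity

/-- The modular `j`-invariant `j = E₄³/Δ = 1/q + 744 + ⋯`. -/
def jInv (τ : ℍ) : ℂ := ModularForm.E₄ τ ^ 3 / ModularForm.discriminant τ

/-- The hyperbolic Green function `g_∞(τ) = -log((4π Im τ)⁶ |Δ(τ)|)`. -/
def gInfty (τ : ℍ) : ℝ :=
  -Real.log ((4 * Real.pi * τ.im) ^ 6 * ‖ModularForm.discriminant τ‖)

/-- `j_𝔻 = j ∘ ψ`; only its values on the open unit disc, where `0 < Im (ψ w)`, are meaningful. -/
def jDisc (w : ℂ) : ℂ := jInv (ofComplex (psi w))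

/-- `g_𝔻 = g_∞ ∘ ψ`; only its values on the open unit disc are meaningful. -/
def gDisc (w : ℂ) : ℝ := gInfty (ofComplex (psi w))

/-- `ĥ(w) = Δ(ψ(w)) / (1 + w)¹²`; only its values on the open unit disc are meaningful. -/
def hHat (w : ℂ) : ℂ := ModularForm.discriminant (ofComplex (psi w)) / (1 + w) ^ 12

/-- `f` is the holomorphic function on the unit disc with `j_𝔻(w) = f(w³)`. -/
def IsCubicFactor (f : ℂ → ℂ) : Prop :=
  DifferentiableOn ℂ f (Metric.ball 0 1) ∧ ∀ w ∈ Metric.ball (0 : ℂ) 1, jDisc w = f (w ^ 3)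

/-- `L` is a holomorphic branch of `log ĥ` on the unit disc. -/
def IsLogBranch (L : ℂ → ℂ) : Prop :=
  DifferentiableOn ℂ L (Metric.ball 0 1) ∧
    ∀ w ∈ Metric.ball (0 : ℂ) 1, Complex.exp (L w) = hHat w

end FaltingsApprox

end

/-! ### Ramanujan's differential equations for `E2` and `E₄`. -/

noncomputable section

namespace FaltingsApprox

open Derivative EisensteinSeries ModularForm MatrixGroups Filter Topology Manifold
open scoped Real

/-! The order-three stabilizer of `ρ` acts on the disc as `w ↦ ρ² w`. Both `j ∘ ψ` and `ĥ` are
invariant under it, and so is any branch `L` of `log ĥ`. Hence `L = L(0) + a w³ + w⁶ κ(w)`, and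
since `g_𝔻 = const - Re L - 6 log(1 - |w|²)`, all three estimates are bounds on `κ`, `κ'`, `κ''`
once `a` is known.

The coefficient comes from Ramanujan's equations. With `k = 2π√3`, the equation for `E2` reads `k²
E₄/(1+w)⁴ = L'² - 12 L''` on the disc, so `E₄` vanishes at `ρ` with first-order coefficient
`-72a/k²`. The equation for `E₄` gives that coefficient as `-k E₆(ρ)/3`. Since `Δ(ρ) =
-E₆(ρ)²/1728`, the `w³` coefficient of `j = E₄³/Δ` is `64 k³ E₆(ρ) = 13824 a`
(`cubic_coefficient_eq`). It is real because `q` is real at `ρ`.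

The remainder needs only a one-sided bound: `(Im τ)⁶ |Δ|` is bounded on `ℍ` by ten times its value
at `ρ` (`norm_hHat_le`), so `Re (L - L(0)) ≤ 13` for `|w| ≤ 9/10`. A Borel–Carathéodory argument in
`z = w³` gives `|κ| ≤ 170` for `|w| ≤ 2/5` (`IsLogBranch.exists_expansion`), and Cauchy's estimates
control the derivatives on `|w| ≤ 1/10`, which contains the required disc. -/

/-- The normalized derivative of a periodic holomorphic function bounded at `i∞` tends to `0`. -/
theorem tendsto_normalizedDeriv_atImInfty {F : ℍ → ℂ} (hF : MDiff F)
    (hper : Function.Periodic (F ∘ ofComplex) 1) (hbdd : IsBoundedAtImInfty F) :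
    Tendsto (normalizedDerivOfComplex F) atImInfty (𝓝 0) := by
  have hper' : Function.Periodic (F ∘ ofComplex) ((1 : ℝ) : ℂ) := by simpa using hper
  set φ := cuspFunction 1 F
  have hφ : AnalyticAt ℂ φ 0 := analyticAt_cuspFunction_zero one_pos hper' hF hbdd
  have hq : Tendsto (fun τ : ℍ ↦ Function.Periodic.qParam 1 τ) atImInfty (𝓝 0) :=
    qParam_tendsto_atImInfty one_pos
  -- In the variable `q` the normalized derivative is `q · d/dq`, which kills the constant term.
  have hlim : Tendsto (fun q : ℂ ↦ q * deriv φ q) (𝓝 0) (𝓝 0) := by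
    have := (continuousAt_id.mul hφ.deriv.continuousAt).tendsto
    simpa [Pi.mul_def] using this
  refine (hlim.comp hq).congr fun τ ↦ ?_
  have hqd : HasDerivAt (Function.Periodic.qParam 1)
      (2 * π * Complex.I * Function.Periodic.qParam 1 τ) (τ : ℂ) := by
    have h : HasDerivAt (fun z : ℂ ↦ 2 * π * Complex.I * z / ((1 : ℝ) : ℂ)) (2 * π * Complex.I)
        (τ : ℂ) := by
      simpa using (hasDerivAt_id (τ : ℂ)).const_mul (2 * π * Complex.I)
    have := h.cexp
    rw [mul_comm (Complex.exp _)] at this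
    exact this
  have hφd : DifferentiableAt ℂ φ (Function.Periodic.qParam 1 τ) :=
    differentiableAt_cuspFunction one_pos hper' hF hbdd
      (Function.Periodic.norm_qParam_lt_one one_pos τ.im_pos)
  have hcomp := hφd.hasDerivAt.comp (τ : ℂ) hqd
  have heq : F ∘ ofComplex =ᶠ[𝓝 (τ : ℂ)] φ ∘ Function.Periodic.qParam 1 := by
    filter_upwards [isOpen_upperHalfPlaneSet.mem_nhds τ.im_pos] with z hz
    have := eq_cuspFunction (f := F) ⟨z, hz⟩ one_ne_zero hper'
    simp only [Function.comp_apply, ofComplex_apply_of_im_pos hz]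
    exact this.symm
  rw [normalizedDerivOfComplex, (hcomp.congr_of_eventuallyEq heq).deriv]
  have : (2 * π * Complex.I : ℂ) ≠ 0 := Complex.two_pi_I_ne_zero
  simp only [Function.comp_apply]
  field_simp

theorem E2_vadd_one (τ : ℍ) : E2 ((1 : ℝ) +ᵥ τ) = E2 τ := by
  rw [E2_eq_tsum_cexp, E2_eq_tsum_cexp]
  have : Complex.exp (2 * π * Complex.I * (((1 : ℝ) +ᵥ τ : ℍ) : ℂ)) =
      Complex.exp (2 * π * Complex.I * (τ : ℂ)) := by
    rw [UpperHalfPlane.coe_vadd, mul_add, add_comm]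
    simp [Complex.exp_add]
  simp only [this]

theorem periodic_comp_ofComplex_of_vadd_one {F : ℍ → ℂ} (h : ∀ τ : ℍ, F ((1 : ℝ) +ᵥ τ) = F τ) :
    Function.Periodic (F ∘ ofComplex) 1 := by
  intro w
  by_cases! hw : 0 < w.im
  · have h1 : 0 < (w + 1).im := by simpa using hw
    simp only [Function.comp_apply, ofComplex_apply_of_im_pos hw, ofComplex_apply_of_im_pos h1]
    rw [← h ⟨w, hw⟩]
    congr 1
    ext
    simp [add_comm]
  -- Off the upper half-plane `ofComplex` takes one fixed default value, so periodicity is trivial.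
  · have h1 : (w + 1).im ≤ 0 := by simpa using hw
    simp only [Function.comp_apply, ofComplex_apply_of_im_nonpos hw,
      ofComplex_apply_of_im_nonpos h1]

theorem tendsto_E2_atImInfty : Tendsto E2 atImInfty (𝓝 1) := by
  have hper : Function.Periodic (E2 ∘ ofComplex) ((1 : ℝ) : ℂ) := by
    simpa using periodic_comp_ofComplex_of_vadd_one E2_vadd_one
  have hφ := analyticAt_cuspFunction_zero one_pos hper E2_mdifferentiable isBoundedAtImInfty_E2
  have h0 : cuspFunction 1 E2 0 = 1 := by
    have := (hasFPowerSeriesOnBall_cuspFunction one_pos hφ fun τ ↦ by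
      simpa only [Function.Periodic.qParam, Complex.ofReal_one, div_one]
        using hasSum_qExpansion_E2 τ).coeff_zero ![]
    simpa [FormalMultilinearSeries.ofScalars] using this.symm
  have := hφ.continuousAt.tendsto.comp (qParam_tendsto_atImInfty one_pos)
  rw [h0] at this
  exact this.congr fun τ ↦ eq_cuspFunction τ one_ne_zero hper

theorem modularForm_periodic {k : ℤ} (f : ModularForm 𝒮ℒ k) :
    Function.Periodic (f ∘ ofComplex) 1 := by
  simpa using SlashInvariantFormClass.periodic_comp_ofComplex f one_mem_strictPeriods_SL

theorem tendsto_E_atImInfty {k : ℕ} (hk : 3 ≤ k) (hk2 : Even k) :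
    Tendsto (E hk) atImInfty (𝓝 1) := by
  have hφ := ModularFormClass.analyticAt_cuspFunction_zero (E hk) one_pos one_mem_strictPeriods_SL
  have h0 : cuspFunction 1 (E hk) 0 = 1 := by
    simpa [qExpansion_coeff] using E_qExpansion_coeff_zero hk hk2
  have := hφ.continuousAt.tendsto.comp (qParam_tendsto_atImInfty one_pos)
  rw [h0] at this
  exact this.congr fun τ ↦
    SlashInvariantFormClass.eq_cuspFunction _ τ one_mem_strictPeriods_SL one_ne_zero

/-- A holomorphic function invariant under `SL(2, ℤ)` in weight `k` with a limit at `i∞` is a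
modular form of level one. -/
def modularFormOfTendsto (k : ℤ) (F : ℍ → ℂ) (hF : MDiff F) (hinv : ∀ γ : SL(2, ℤ), F ∣[k] γ = F)
    {c : ℂ} (hc : Tendsto F atImInfty (𝓝 c)) : ModularForm 𝒮ℒ k where
  toFun := F
  slash_action_eq' A hA := by
    obtain ⟨A, rfl⟩ := hA
    exact hinv A
  holo' := hF
  bdd_at_cusps' h := by
    rw [Subgroup.IsArithmetic.isCusp_iff_isCusp_SL2Z] at h
    rw [OnePoint.isBoundedAt_iff_forall_SL2Z h]
    intro γ _
    rw [hinv]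
    exact hc.isBigO_one ℝ

/-- In a one-dimensional space of forms the limit at `i∞` fixes the multiple, as the Eisenstein
series tends to `1`. -/
theorem eq_smul_E_of_rank_one {k : ℕ} (hk : 3 ≤ k) (hk2 : Even k)
    (hrank : Module.rank ℂ (ModularForm 𝒮ℒ k) = 1) {F : ℍ → ℂ} (hF : MDiff F)
    (hinv : ∀ γ : SL(2, ℤ), F ∣[(k : ℤ)] γ = F) {c : ℂ} (hc : Tendsto F atImInfty (𝓝 c)) (τ : ℍ) :
    F τ = c * E hk τ := by
  obtain ⟨d, hd⟩ : ∃ d : ℂ, d • E hk = modularFormOfTendsto k F hF hinv hc :=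
    (finrank_eq_one_iff_of_nonzero' (E hk) (E_ne_zero _ hk2)).mp
      (Module.rank_eq_one_iff_finrank_eq_one.mp hrank) _
  have hd' : ∀ τ, F τ = d * E hk τ := fun τ ↦ (DFunLike.congr_fun hd τ).symm
  have h1 : Tendsto F atImInfty (𝓝 (d * 1)) := by
    rw [show F = fun τ ↦ d * E hk τ from funext hd']
    exact (tendsto_E_atImInfty hk hk2).const_mul d
  have : c = d := by simpa using tendsto_nhds_unique hc h1
  rw [hd', this]

/-- The Serre derivative of `E₄` is modular of weight 6, hence a multiple of `E₆`; its limit `-4/12`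
gives the factor. -/
theorem normalizedDeriv_E4 (τ : ℍ) :
    normalizedDerivOfComplex E₄ τ = (E2 τ * E₄ τ - E₆ τ) / 3 := by
  have hm : MDiff (E₄ : ℍ → ℂ) := ModularFormClass.holo E₄
  have hb : IsBoundedAtImInfty (E₄ : ℍ → ℂ) := ModularFormClass.bdd_at_infty E₄
  have hD := tendsto_normalizedDeriv_atImInfty hm (modularForm_periodic E₄) hb
  have h4 : Tendsto (E₄ : ℍ → ℂ) atImInfty (𝓝 1) := tendsto_E_atImInfty _ ⟨2, rfl⟩
  have hlim : Tendsto (serreDerivative ((4 : ℤ) : ℂ) E₄) atImInfty (𝓝 (-1 / 3)) := by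
    have := hD.sub (((tendsto_E2_atImInfty.const_mul (4 * 12⁻¹))).mul h4)
    norm_num at this ⊢
    exact this
  have := eq_smul_E_of_rank_one (k := 6) (by norm_num) ⟨3, rfl⟩ levelOne_weight_six_rank_one
    (serreDerivative_mdifferentiable ((4 : ℤ) : ℂ) hm)
    (fun γ ↦ serreDerivative_slash_invariant (k := 4) hm
      (SlashInvariantForm.slash_action_eqn E₄.toSlashInvariantForm _ ⟨γ, rfl⟩)) hlim τ
  rw [serreDerivative_apply] at this
  push_cast at this
  linear_combination this

/-- Although `E2` has weight 2, the Serre derivative is taken with parameter 1: only for `D E2 -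
E2²/12` do the anomalies of `D E2` and of `E2²` cancel, leaving a form of weight 4. -/
theorem normalizedDeriv_E2 (τ : ℍ) :
    normalizedDerivOfComplex E2 τ = (E2 τ ^ 2 - E₄ τ) / 12 := by
  have hm := E2_mdifferentiable
  have hD := tendsto_normalizedDeriv_atImInfty hm (periodic_comp_ofComplex_of_vadd_one E2_vadd_one)
    isBoundedAtImInfty_E2
  have hlim : Tendsto (serreDerivative 1 E2) atImInfty (𝓝 (-1 / 12)) := by
    have := hD.sub (((tendsto_E2_atImInfty.const_mul (1 * 12⁻¹))).mul tendsto_E2_atImInfty)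
    norm_num at this ⊢
    exact this
  have hinv (γ : SL(2, ℤ)) : serreDerivative 1 E2 ∣[(4 : ℤ)] γ = serreDerivative 1 E2 := by
    ext z
    have h1 := congrFun (normalizedDerivOfComplex_SL_slash (k := 2) hm (γ := γ)) z
    have h2 := congrFun (E2_slash_action γ) z
    have hg : denom γ z ≠ 0 := denom_ne_zero _ z
    -- Differentiating the quasi-modular correction, a multiple of `1/denom`, produces the
    -- `1/denom²` term.
    have h3 : normalizedDerivOfComplex (E2 ∣[(2 : ℤ)] γ) z = normalizedDerivOfComplex E2 z
        + 3 / π ^ 2 * (γ 1 0 / denom γ z) ^ 2 := by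
      have hE := (UpperHalfPlane.mdifferentiableAt_iff.mp (hm z)).hasDerivAt
      have hd := hasDerivAt_denom_zpow (γ : GL (Fin 2) ℝ) (-1) z
      have hs := hE.sub (hd.const_mul (1 / (2 * riemannZeta 2) * (2 * π * Complex.I * γ 1 0)))
      have heq : (E2 ∣[(2 : ℤ)] γ) ∘ ofComplex =ᶠ[𝓝 (z : ℂ)] (E2 ∘ ofComplex) -
          fun w ↦ 1 / (2 * riemannZeta 2) * (2 * π * Complex.I * γ 1 0) *
            denom (γ : GL (Fin 2) ℝ) w ^ (-1 : ℤ) := by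
        filter_upwards [isOpen_upperHalfPlaneSet.mem_nhds z.im_pos] with w hw
        simp only [Function.comp_apply, E2_slash_action, Pi.sub_apply, Pi.smul_apply, D2,
          smul_eq_mul, ofComplex_apply_of_im_pos hw]
        simp [div_eq_mul_inv, mul_assoc]
      rw [normalizedDerivOfComplex, (hs.congr_of_eventuallyEq heq).deriv, normalizedDerivOfComplex,
        riemannZeta_two]
      have hc : (((γ : GL (Fin 2) ℝ) 1 0 : ℝ) : ℂ) = ((γ 1 0 : ℤ) : ℂ) := by simp
      rw [hc]
      have hpi : (π : ℂ) ≠ 0 := by exact_mod_cast Real.pi_ne_zero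
      have hI : Complex.I ≠ 0 := Complex.I_ne_zero
      rw [show (-1 - 1 : ℤ) = -2 by norm_num, zpow_neg]
      push_cast
      field_simp
      norm_cast
      ring
    have h1' : normalizedDerivOfComplex E2 z + 3 / π ^ 2 * (γ 1 0 / denom γ z) ^ 2 =
        (normalizedDerivOfComplex E2 ∣[(4 : ℤ)] γ) z -
          2 * (2 * π * Complex.I)⁻¹ * (γ 1 0 / denom γ z) * (E2 ∣[(2 : ℤ)] γ) z := by
      rw [← h3]
      exact_mod_cast h1
    have h2' : (E2 ∣[(2 : ℤ)] γ) z =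
        E2 z - 1 / (2 * riemannZeta 2) * (2 * π * Complex.I * γ 1 0 / denom γ z) := h2
    have h4 : (serreDerivative 1 E2 ∣[(4 : ℤ)] γ) z =
        (normalizedDerivOfComplex E2 ∣[(4 : ℤ)] γ) z - 12⁻¹ * (E2 ∣[(2 : ℤ)] γ) z ^ 2 := by
      simp only [ModularForm.SL_slash_apply, serreDerivative_apply]
      rw [mul_pow, ← zpow_natCast (denom _ _ ^ _), ← zpow_mul]
      norm_num
      ring
    rw [h2'] at h1' h4
    rw [h4, eq_add_of_sub_eq h1'.symm, serreDerivative_apply, riemannZeta_two]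
    have hpi : (π : ℂ) ≠ 0 := by exact_mod_cast Real.pi_ne_zero
    have hI : Complex.I ≠ 0 := Complex.I_ne_zero
    field_simp
    linear_combination (12 * π * denom γ z * γ 1 0 * E2 z - 36 * (γ 1 0 : ℂ) ^ 2 * Complex.I) *
      Complex.I_sq
  have := eq_smul_E_of_rank_one (k := 4) (by norm_num) ⟨2, rfl⟩ levelOne_weight_four_rank_one
    (serreDerivative_mdifferentiable 1 hm) hinv hlim τ
  rw [serreDerivative_apply] at this
  linear_combination this

end FaltingsApprox

end

/-! ### Complex analysis on discs: functions of `w³`, Taylor remainders, logarithms. -/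

noncomputable section

namespace FaltingsApprox

open Metric Set Filter Topology

/-- A holomorphic function on the unit disc invariant under rotation by a primitive cube root of
unity is a holomorphic function of `w ^ 3`. -/
theorem exists_differentiableOn_comp_cube {F : ℂ → ℂ} {ζ : ℂ} (hζ : ζ ^ 2 + ζ + 1 = 0)
    (hF : DifferentiableOn ℂ F (ball 0 1)) (hinv : ∀ w ∈ ball (0 : ℂ) 1, F (ζ * w) = F w) :
    ∃ f : ℂ → ℂ, DifferentiableOn ℂ f (ball 0 1) ∧ ∀ w ∈ ball (0 : ℂ) 1, F w = f (w ^ 3) := by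
  have hζ3 : ζ ^ 3 = 1 := by linear_combination (ζ - 1) * hζ
  have hζn : ‖ζ‖ = 1 := by
    have h : ‖ζ‖ ^ 3 = 1 := by rw [← norm_pow, hζ3, norm_one]
    exact (pow_eq_one_iff_of_nonneg (norm_nonneg _) (by norm_num)).mp h
  have hcube (x y : ℂ) (hx : x ∈ ball (0 : ℂ) 1) (hxy : y ^ 3 = x ^ 3) : F y = F x := by
    have hprod : (y - x) * ((y - ζ * x) * (y - ζ * (ζ * x))) = 0 := by
      linear_combination hxy + (-(x * y ^ 2) + x ^ 2 * y * ζ - x ^ 3 * (ζ - 1)) * hζ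
    rcases mul_eq_zero.mp hprod with h | h
    · rw [sub_eq_zero.mp h]
    rcases mul_eq_zero.mp h with h | h
    · rw [sub_eq_zero.mp h, hinv x hx]
    · rw [sub_eq_zero.mp h, hinv (ζ * x) (by simpa [hζn] using hx), hinv x hx]
  -- The principal cube root jumps across the cut, but `F ∘ r` does not: by invariance `F` depends
  -- only on the cube of its argument.
  let r : ℂ → ℂ := fun z ↦ z ^ (((3 : ℕ) : ℂ)⁻¹)
  have hr (z : ℂ) : r z ^ 3 = z := Complex.cpow_nat_inv_pow z (by norm_num)
  have key : ∀ w ∈ ball (0 : ℂ) 1, F w = F (r (w ^ 3)) := fun w hw ↦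
    (hcube w _ hw (hr _)).symm
  refine ⟨fun z ↦ F (r z), ?_, key⟩
  rw [← Complex.differentiableOn_compl_singleton_and_continuousAt_iff
    (ball_mem_nhds (0 : ℂ) one_pos)]
  constructor
  · rintro z ⟨hz, hz0⟩
    replace hz0 : z ≠ 0 := hz0
    -- A cube root holomorphic near `z` even when `z` lies on the cut, since `x / z` is near `1`.
    let c : ℂ → ℂ := fun x ↦ r z * r (x / z)
    have hc3 (x : ℂ) : c x ^ 3 = x := by
      simp only [c, mul_pow, hr]
      field_simp
    have hc : DifferentiableAt ℂ c z := by
      refine DifferentiableAt.const_mul ?_ _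
      refine DifferentiableAt.cpow_const (differentiableAt_id.div_const z) ?_
      simp [hz0, Complex.mem_slitPlane_iff]
    have hcz : c z ∈ ball (0 : ℂ) 1 := by
      rw [mem_ball_zero_iff] at hz ⊢
      rw [← hc3 z, norm_pow] at hz
      exact (pow_lt_one_iff_of_nonneg (norm_nonneg _) (by norm_num)).mp hz
    have hd : DifferentiableAt ℂ (F ∘ c) z :=
      (hF.differentiableAt (isOpen_ball.mem_nhds hcz)).comp z hc
    refine (hd.congr_of_eventuallyEq ?_).differentiableWithinAt
    filter_upwards [hc.continuousAt.preimage_mem_nhds (isOpen_ball.mem_nhds hcz)] with x hx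
    exact hcube _ _ hx (by rw [hr, hc3])
  · have hr0 : r 0 = 0 := by simp [r]
    have hrc : ContinuousAt r 0 := by
      exact Complex.continuousAt_cpow_const_of_re_pos (by simp) (by norm_num)
    refine ContinuousAt.comp (f := r) (g := F) ?_ hrc
    rw [hr0]
    exact (hF.differentiableAt (ball_mem_nhds (0 : ℂ) one_pos)).continuousAt

/-- A Borel–Carathéodory bound for the second order Taylor remainder. -/
theorem exists_quadratic_remainder_of_re_le {Φ : ℂ → ℂ} {R A : ℝ} (hR : 0 < R) (hA : 0 < A)
    (hΦ : DifferentiableOn ℂ Φ (ball 0 R)) (h0 : Φ 0 = 0)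
    (hre : ∀ z ∈ ball (0 : ℂ) R, (Φ z).re ≤ A) :
    ∃ (a : ℂ) (χ : ℂ → ℂ), DifferentiableOn ℂ χ (ball 0 R) ∧
      (∀ z ∈ ball (0 : ℂ) R, Φ z = a * z + z ^ 2 * χ z) ∧
      ∀ z ∈ ball (0 : ℂ) R, ‖χ z‖ ≤ 6 * A / (R * (R - ‖z‖)) := by
  have hR0 : ball (0 : ℂ) R ∈ 𝓝 (0 : ℂ) := ball_mem_nhds _ hR
  have hmem0 : (0 : ℂ) ∈ ball (0 : ℂ) R := mem_ball_self hR
  have hne : ∀ z ∈ ball (0 : ℂ) R, 2 * (A : ℂ) - Φ z ≠ 0 := by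
    intro z hz h
    have h1 := congrArg Complex.re h
    have h2 := hre z hz
    simp at h1
    linarith
  -- This Möbius map sends the half-plane `Re ≤ A` into the unit disc and fixes `0`, so Schwarz's
  -- lemma bounds `H = G/z`, and then `K = (H - H(0))/z`.
  let G : ℂ → ℂ := fun z ↦ Φ z / (2 * A - Φ z)
  have hG : DifferentiableOn ℂ G (ball 0 R) := hΦ.div (hΦ.const_sub _) hne
  have hG0 : G 0 = 0 := by simp [G, h0]
  have hGmaps : MapsTo G (ball 0 R) (closedBall (G 0) 1) := by
    intro z hz
    rw [hG0, mem_closedBall_zero_iff]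
    simp only [G, norm_div]
    refine div_le_one_of_le₀ ?_ (norm_nonneg _)
    rw [← sq_le_sq₀ (norm_nonneg _) (norm_nonneg _), Complex.sq_norm, Complex.sq_norm,
      Complex.normSq_apply, Complex.normSq_apply]
    have := hre z hz
    simp
    nlinarith
  let H : ℂ → ℂ := dslope G 0
  have hH : DifferentiableOn ℂ H (ball 0 R) := (Complex.differentiableOn_dslope hR0).mpr hG
  have hHn : ∀ z ∈ ball (0 : ℂ) R, ‖H z‖ ≤ 1 / R := fun z hz ↦
    Complex.norm_dslope_le_div_of_mapsTo_ball hG hGmaps hz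
  have hGH : ∀ z, G z = z * H z := by
    intro z
    have := sub_smul_dslope G 0 z
    rw [hG0] at this
    simpa using this.symm
  let K : ℂ → ℂ := dslope H 0
  have hK : DifferentiableOn ℂ K (ball 0 R) := (Complex.differentiableOn_dslope hR0).mpr hH
  have hKn : ∀ z ∈ ball (0 : ℂ) R, ‖K z‖ ≤ 2 / R / R := fun z hz ↦ by
    refine Complex.norm_dslope_le_div_of_mapsTo_ball hH (fun x hx ↦ ?_) hz
    rw [mem_closedBall, dist_eq_norm]
    refine (norm_sub_le _ _).trans ?_
    have := hHn x hx
    have := hHn 0 hmem0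
    rw [show 2 / R = 1 / R + 1 / R by ring]
    linarith
  have hHK : ∀ z, H z = H 0 + z * K z := by
    intro z
    have := sub_smul_dslope H 0 z
    simp only [sub_zero, smul_eq_mul] at this
    simp only [K, this]
    ring
  have hzH : ∀ z ∈ ball (0 : ℂ) R, ‖z * H z‖ ≤ ‖z‖ / R := by
    intro z hz
    rw [norm_mul, div_eq_mul_one_div]
    exact mul_le_mul_of_nonneg_left (hHn z hz) (norm_nonneg _)
  have hlow : ∀ z ∈ ball (0 : ℂ) R, 1 - ‖z‖ / R ≤ ‖1 + z * H z‖ := by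
    intro z hz
    have h1 := norm_sub_le_norm_add 1 (z * H z)
    have h2 := hzH z hz
    rw [norm_one] at h1
    linarith
  have hpos : ∀ z ∈ ball (0 : ℂ) R, 0 < 1 - ‖z‖ / R := by
    intro z hz
    rw [mem_ball_zero_iff] at hz
    rw [sub_pos, div_lt_one hR]
    exact hz
  have hne1 : ∀ z ∈ ball (0 : ℂ) R, 1 + z * H z ≠ 0 := fun z hz ↦
    norm_pos_iff.mp ((hpos z hz).trans_le (hlow z hz))
  -- Inverting the Möbius map gives `Φ = 2A zH/(1 + zH)`; subtracting `2A H(0) z` leaves this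
  -- quotient times `z²`.
  refine ⟨2 * A * H 0, fun z ↦ 2 * A * (K z - H 0 * H z) / (1 + z * H z), ?_, ?_, ?_⟩
  · exact ((hK.sub (hH.const_mul _)).const_mul _).div
      ((differentiableOn_id.mul hH).const_add 1) hne1
  · intro z hz
    have h1 := hne1 z hz
    have h2 : Φ z * (1 + z * H z) = 2 * A * (z * H z) := by
      have h3 := hne z hz
      rw [← hGH]
      simp only [G]
      field_simp
      ring
    field_simp
    rw [h2]
    linear_combination (2 * A * z) * hHK z
  · intro z hz
    have hp := hpos z hz
    have hK' := hKn z hz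
    have hH' := hHn z hz
    have hH0 := hHn 0 hmem0
    have hnum : ‖2 * (A : ℂ) * (K z - H 0 * H z)‖ ≤ 6 * A / R ^ 2 := by
      rw [norm_mul, norm_mul, Complex.norm_real, Real.norm_of_nonneg hA.le, Complex.norm_ofNat]
      have h1 : ‖K z - H 0 * H z‖ ≤ 2 / R / R + 1 / R * (1 / R) := by
        refine (norm_sub_le _ _).trans (add_le_add hK' ?_)
        rw [norm_mul]
        gcongr
      calc 2 * A * ‖K z - H 0 * H z‖ ≤ 2 * A * (2 / R / R + 1 / R * (1 / R)) := by gcongr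
        _ = 6 * A / R ^ 2 := by field_simp; ring
    rw [norm_div]
    calc _ ≤ 6 * A / R ^ 2 / (1 - ‖z‖ / R) := by gcongr; exact hlow z hz
      _ = 6 * A / (R * (R - ‖z‖)) := by
        have : R - ‖z‖ ≠ 0 := by
          rw [mem_ball_zero_iff] at hz
          linarith
        rw [one_sub_div hR.ne']
        field_simp

/-- A nowhere vanishing holomorphic function on a disc has a holomorphic logarithm. -/
theorem exists_log_of_ne_zero {h : ℂ → ℂ} {r : ℝ} (hr : 0 < r)
    (hh : DifferentiableOn ℂ h (ball 0 r)) (h0 : ∀ w ∈ ball (0 : ℂ) r, h w ≠ 0) :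
    ∃ L : ℂ → ℂ, DifferentiableOn ℂ L (ball 0 r) ∧
      ∀ w ∈ ball (0 : ℂ) r, Complex.exp (L w) = h w := by
  have hm : (0 : ℂ) ∈ ball (0 : ℂ) r := mem_ball_self hr
  have hq : DifferentiableOn ℂ (fun w ↦ deriv h w / h w) (ball 0 r) :=
    (hh.deriv isOpen_ball).div hh h0
  obtain ⟨L, hL0, hL⟩ := hq.isExactOn_ball.with_val_at 0 (Complex.log (h 0))
  refine ⟨L, fun w hw ↦ (hL w hw).differentiableAt.differentiableWithinAt, fun w hw ↦ ?_⟩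
  have hd : ∀ x ∈ ball (0 : ℂ) r, HasDerivAt (fun w ↦ Complex.exp (-L w) * h w) 0 x := by
    intro x hx
    have h1 := ((hL x hx).neg.cexp).mul (hh.differentiableAt (isOpen_ball.mem_nhds hx)).hasDerivAt
    have h2 := h0 x hx
    refine h1.congr_deriv ?_
    change Complex.exp (-L x) * -(deriv h x / h x) * h x + Complex.exp (-L x) * deriv h x = 0
    field_simp
    ring
  have hconst : Complex.exp (-L w) * h w = Complex.exp (-L 0) * h 0 :=
    isOpen_ball.is_const_of_deriv_eq_zero (convex_ball _ _).isPreconnected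
      (fun x hx ↦ (hd x hx).differentiableAt.differentiableWithinAt)
      (fun x hx ↦ (hd x hx).deriv) hw hm
  rw [hL0, Complex.exp_neg, Complex.exp_neg, Complex.exp_log (h0 0 hm),
    inv_mul_cancel₀ (h0 0 hm)] at hconst
  have := Complex.exp_ne_zero (L w)
  field_simp at hconst
  exact hconst.symm

end FaltingsApprox

end

/-! ### Transport to the disc and the threefold symmetry at `ρ`. -/

noncomputable section

namespace FaltingsApprox

open Derivative EisensteinSeries ModularForm MatrixGroups Filter Topology Manifold Metric
open scoped Real

theorem rho_sq : rho ^ 2 = rho - 1 := by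
  have h3 : Real.sqrt 3 * Real.sqrt 3 = 3 := Real.mul_self_sqrt (by norm_num)
  apply Complex.ext
  · simp [rho, pow_two]
    linarith
  · simp [rho, pow_two]
    ring

theorem conj_rho : (starRingEnd ℂ) rho = 1 - rho := by
  apply Complex.ext
  · simp [rho]
    norm_num
  · simp [rho]

theorem one_sub_two_mul_rho : 1 - 2 * rho = -(Real.sqrt 3 * Complex.I) := by
  apply Complex.ext
  · simp [rho]
  · simp [rho]
    ring

theorem psi_eq (w : ℂ) : psi w = ((1 - rho) * w + rho) / (w + 1) := by
  rw [psi, conj_rho]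

theorem psi_zero : psi 0 = rho := by simp [psi]

theorem one_add_ne_zero_of_mem_ball {w : ℂ} (hw : w ∈ ball (0 : ℂ) 1) : w + 1 ≠ 0 := by
  intro h
  rw [mem_ball_zero_iff, eq_neg_of_add_eq_zero_left h] at hw
  simp at hw

theorem coe_ofComplex_psi {w : ℂ} (hw : w ∈ ball (0 : ℂ) 1) :
    ((ofComplex (psi w) : ℍ) : ℂ) = psi w := by
  rw [ofComplex_apply_of_im_pos (psi_im_pos hw)]

theorem hasDerivAt_psi {w : ℂ} (hw : w ∈ ball (0 : ℂ) 1) :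
    HasDerivAt psi (-(Real.sqrt 3 * Complex.I) / (w + 1) ^ 2) w := by
  have h1 := one_add_ne_zero_of_mem_ball hw
  have hn : HasDerivAt (fun w ↦ (1 - rho) * w + rho) (1 - rho) w := by
    simpa using ((hasDerivAt_id w).const_mul (1 - rho)).add_const rho
  have hd : HasDerivAt (fun w : ℂ ↦ w + 1) 1 w := (hasDerivAt_id w).add_const 1
  rw [show psi = fun w ↦ ((1 - rho) * w + rho) / (w + 1) from funext psi_eq]
  refine (hn.div hd h1).congr_deriv ?_
  rw [← one_sub_two_mul_rho]
  ring

/-- The factor `2π√3` by which the normalized derivative is rescaled on the disc. -/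
def discScale : ℝ := 2 * π * Real.sqrt 3

theorem discScale_pos : 0 < discScale := by
  unfold discScale
  positivity

theorem hasDerivAt_comp_psi {F : ℍ → ℂ} (hF : MDiff F) {w : ℂ} (hw : w ∈ ball (0 : ℂ) 1) :
    HasDerivAt (fun w ↦ F (ofComplex (psi w)))
      (discScale * normalizedDerivOfComplex F (ofComplex (psi w)) / (w + 1) ^ 2) w := by
  have h1 : HasDerivAt (F ∘ ofComplex) (deriv (F ∘ ofComplex) (psi w)) (psi w) := by
    have := (UpperHalfPlane.mdifferentiableAt_iff.mp (hF (ofComplex (psi w)))).hasDerivAt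
    rwa [coe_ofComplex_psi hw] at this
  refine (h1.comp w (hasDerivAt_psi hw)).congr_deriv ?_
  rw [normalizedDerivOfComplex, coe_ofComplex_psi hw, discScale]
  have hpi : (π : ℂ) ≠ 0 := by exact_mod_cast Real.pi_ne_zero
  have hI : Complex.I ≠ 0 := Complex.I_ne_zero
  have h2 := one_add_ne_zero_of_mem_ball hw
  push_cast
  field_simp
  rw [Complex.I_sq]
  ring

theorem hasDerivAt_comp_psi_div {F : ℍ → ℂ} (hF : MDiff F) (n : ℕ) {w : ℂ}
    (hw : w ∈ ball (0 : ℂ) 1) :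
    HasDerivAt (fun w ↦ F (ofComplex (psi w)) / (1 + w) ^ n)
      (discScale * normalizedDerivOfComplex F (ofComplex (psi w)) / (1 + w) ^ (n + 2) -
        n * F (ofComplex (psi w)) / (1 + w) ^ (n + 1)) w := by
  have h2 : 1 + w ≠ 0 := by
    rw [add_comm]
    exact one_add_ne_zero_of_mem_ball hw
  have hd : HasDerivAt (fun w : ℂ ↦ (1 + w) ^ n) (n * (1 + w) ^ (n - 1) * 1) w :=
    ((hasDerivAt_id w).const_add 1).pow n
  refine ((hasDerivAt_comp_psi hF hw).div hd (pow_ne_zero n h2)).congr_deriv ?_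
  rw [add_comm w 1]
  rcases n with _ | n
  · simp
  · simp only [Nat.add_sub_cancel]
    field_simp
    ring

theorem mdifferentiable_discriminant : MDiff discriminant := CuspForm.discriminant.holo'

theorem hHat_ne_zero {w : ℂ} (hw : w ∈ ball (0 : ℂ) 1) : hHat w ≠ 0 := by
  refine div_ne_zero (discriminant_ne_zero _) (pow_ne_zero _ ?_)
  rw [add_comm]
  exact one_add_ne_zero_of_mem_ball hw

theorem differentiableOn_hHat : DifferentiableOn ℂ hHat (ball 0 1) := fun _ hw ↦
  (hasDerivAt_comp_psi_div mdifferentiable_discriminant 12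
    hw).differentiableAt.differentiableWithinAt

theorem differentiableOn_jDisc : DifferentiableOn ℂ jDisc (ball 0 1) := fun w hw ↦ by
  have h4 := hasDerivAt_comp_psi (ModularFormClass.holo E₄) hw
  have hΔ := hasDerivAt_comp_psi mdifferentiable_discriminant hw
  exact ((h4.pow 3).div hΔ (discriminant_ne_zero _)).differentiableAt.differentiableWithinAt

/-- The matrix of `τ ↦ -1 / (τ - 1)`, which fixes `ρ`. -/
def rhoStabilizer : SL(2, ℤ) := ⟨!![0, -1; 1, -1], by simp [Matrix.det_fin_two]⟩

theorem denom_rhoStabilizer (τ : ℍ) : denom (rhoStabilizer : GL (Fin 2) ℝ) τ = (τ : ℂ) - 1 := by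
  rw [ModularGroup.denom_apply]
  simp [rhoStabilizer, sub_eq_add_neg]

theorem apply_rhoStabilizer_smul {F : ℍ → ℂ} {k : ℤ} (hF : ∀ γ : SL(2, ℤ), F ∣[k] γ = F) (τ : ℍ) :
    F (rhoStabilizer • τ) = ((τ : ℂ) - 1) ^ k * F τ := by
  have h := congrFun (hF rhoStabilizer) τ
  rw [ModularForm.SL_slash_apply] at h
  have hne : (τ : ℂ) - 1 ≠ 0 := denom_rhoStabilizer τ ▸ denom_ne_zero _ τ
  rw [denom_rhoStabilizer] at h
  rw [← h, mul_left_comm, ← zpow_add₀ hne]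
  simp

theorem norm_rho : ‖rho‖ = 1 := by
  have h3 : rho ^ 3 = -1 := by linear_combination (rho + 1) * rho_sq
  have h : ‖rho‖ ^ 3 = 1 := by rw [← norm_pow, h3, norm_neg, norm_one]
  exact (pow_eq_one_iff_of_nonneg (norm_nonneg _) (by norm_num)).mp h

theorem rho_sq_mul_mem_ball {w : ℂ} (hw : w ∈ ball (0 : ℂ) 1) : rho ^ 2 * w ∈ ball (0 : ℂ) 1 := by
  simpa [norm_rho] using hw

theorem psi_sub_one {w : ℂ} (hw : w ∈ ball (0 : ℂ) 1) :
    psi w - 1 = rho ^ 2 * (1 + rho ^ 2 * w) / (1 + w) := by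
  have h1 := one_add_ne_zero_of_mem_ball hw
  rw [psi_eq, add_comm 1 w, eq_div_iff h1, sub_mul, div_mul_cancel₀ _ h1]
  linear_combination (-1 - rho * w - rho ^ 2 * w) * rho_sq

theorem ofComplex_psi_rotate {w : ℂ} (hw : w ∈ ball (0 : ℂ) 1) :
    ofComplex (psi (rho ^ 2 * w)) = rhoStabilizer • ofComplex (psi w) := by
  have hw' := rho_sq_mul_mem_ball hw
  have h1 := one_add_ne_zero_of_mem_ball hw
  have h2 := one_add_ne_zero_of_mem_ball hw'
  have hr : rho ≠ 0 := norm_pos_iff.mp (by simp [norm_rho])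
  ext
  rw [coe_ofComplex_psi hw', coe_specialLinearGroup_apply]
  simp only [rhoStabilizer, Matrix.of_apply, Matrix.cons_val', Matrix.cons_val_zero,
    Matrix.cons_val_one, coe_ofComplex_psi hw]
  simp
  rw [← sub_eq_add_neg, psi_sub_one hw, psi_eq, add_comm 1, add_comm 1]
  field_simp
  linear_combination (-rho ^ 3 * w + rho * w + rho + w + 1) * rho_sq

theorem discriminant_slash (γ : SL(2, ℤ)) : discriminant ∣[(12 : ℤ)] γ = discriminant :=
  CuspForm.discriminant.slash_action_eq' _ ⟨γ, rfl⟩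

theorem E4_slash (γ : SL(2, ℤ)) : (E₄ : ℍ → ℂ) ∣[(4 : ℤ)] γ = E₄ :=
  E₄.slash_action_eq' _ ⟨γ, rfl⟩

/-- The weight-12 factor `(ψ(w) - 1)¹²` is `ρ²⁴ = 1` times the ratio of the two denominators `(1 +
·)¹²`. -/
theorem hHat_rotate {w : ℂ} (hw : w ∈ ball (0 : ℂ) 1) : hHat (rho ^ 2 * w) = hHat w := by
  have hw' := rho_sq_mul_mem_ball hw
  have h1 := one_add_ne_zero_of_mem_ball hw
  have h2 := one_add_ne_zero_of_mem_ball hw'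
  rw [add_comm] at h1 h2
  have h3 : rho ^ 3 = -1 := by linear_combination (rho + 1) * rho_sq
  rw [hHat, hHat, ofComplex_psi_rotate hw, apply_rhoStabilizer_smul discriminant_slash,
    coe_ofComplex_psi hw, psi_sub_one hw]
  rw [show (12 : ℤ) = ((12 : ℕ) : ℤ) from rfl, zpow_natCast, div_pow, mul_pow, ← pow_mul,
    show 2 * 12 = 3 * 8 by norm_num, pow_mul, h3]
  field_simp

theorem jDisc_rotate {w : ℂ} (hw : w ∈ ball (0 : ℂ) 1) : jDisc (rho ^ 2 * w) = jDisc w := by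
  rw [jDisc, jDisc, jInv, jInv, ofComplex_psi_rotate hw,
    apply_rhoStabilizer_smul discriminant_slash, apply_rhoStabilizer_smul E4_slash]
  have hne : ((ofComplex (psi w) : ℍ) : ℂ) - 1 ≠ 0 :=
    denom_rhoStabilizer (ofComplex (psi w)) ▸ denom_ne_zero _ _
  have hΔ := discriminant_ne_zero (ofComplex (psi w))
  rw [zpow_ofNat, zpow_ofNat]
  field_simp

theorem rho_sq_primitive : (rho ^ 2) ^ 2 + rho ^ 2 + 1 = 0 := by
  linear_combination (rho ^ 2 + rho + 1) * rho_sq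

theorem exists_isCubicFactor : ∃ f : ℂ → ℂ, IsCubicFactor f :=
  exists_differentiableOn_comp_cube rho_sq_primitive differentiableOn_jDisc fun _ ↦ jDisc_rotate

theorem exists_isLogBranch : ∃ L : ℂ → ℂ, IsLogBranch L :=
  exists_log_of_ne_zero one_pos differentiableOn_hHat fun _ ↦ hHat_ne_zero

/-- The difference of the two sides is a holomorphic logarithm of `1`, hence constant, and it
vanishes at the fixed point `0`. -/
theorem IsLogBranch.rotate {L : ℂ → ℂ} (hL : IsLogBranch L) {w : ℂ} (hw : w ∈ ball (0 : ℂ) 1) :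
    L (rho ^ 2 * w) = L w := by
  have hd (x : ℂ) (hx : x ∈ ball (0 : ℂ) 1) : HasDerivAt L (deriv L x) x :=
    (hL.1.differentiableAt (isOpen_ball.mem_nhds hx)).hasDerivAt
  have hd2 (x : ℂ) (hx : x ∈ ball (0 : ℂ) 1) : HasDerivAt (fun w ↦ L (rho ^ 2 * w) - L w)
      (deriv L (rho ^ 2 * x) * rho ^ 2 - deriv L x) x := by
    have hm : HasDerivAt (fun w : ℂ ↦ rho ^ 2 * w) (rho ^ 2) x := by
      simpa using (hasDerivAt_id x).const_mul (rho ^ 2)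
    exact ((hd _ (rho_sq_mul_mem_ball hx)).comp x hm).sub (hd x hx)
  have hexp : ∀ x ∈ ball (0 : ℂ) 1, Complex.exp (L (rho ^ 2 * x) - L x) = 1 := by
    intro x hx
    rw [Complex.exp_sub, hL.2 x hx, hL.2 _ (rho_sq_mul_mem_ball hx), hHat_rotate hx,
      div_self (hHat_ne_zero hx)]
  have hzero (x : ℂ) (hx : x ∈ ball (0 : ℂ) 1) :
      deriv (fun w ↦ L (rho ^ 2 * w) - L w) x = 0 := by
    have h1 := (hd2 x hx).cexp
    have h2 : HasDerivAt (fun w ↦ Complex.exp (L (rho ^ 2 * w) - L w)) 0 x :=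
      (hasDerivAt_const x (1 : ℂ)).congr_of_eventuallyEq (by
        filter_upwards [isOpen_ball.mem_nhds hx] with y hy using hexp y hy)
    rw [(hd2 x hx).deriv]
    exact (mul_eq_zero.mp (h1.unique h2)).resolve_left (Complex.exp_ne_zero _)
  have := isOpen_ball.is_const_of_deriv_eq_zero (convex_ball (0 : ℂ) 1).isPreconnected
    (fun x hx ↦ (hd2 x hx).differentiableAt.differentiableWithinAt)
    hzero hw (mem_ball_self one_pos)
  simpa [sub_eq_zero] using this

/-- At `ρ` one has `q = -exp(-π√3)`, and the `q`-expansion has real coefficients. -/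
theorem im_E6_rho (τ : ℍ) (hτ : (τ : ℂ) = rho) : (E₆ τ).im = 0 := by
  have hq : Complex.exp (2 * π * Complex.I * τ) = ((-Real.exp (-(π * Real.sqrt 3)) : ℝ) : ℂ) := by
    have h : 2 * π * Complex.I * rho = π * Complex.I + ((-(π * Real.sqrt 3) : ℝ) : ℂ) := by
      apply Complex.ext
      · simp [rho]
        ring
      · simp [rho]
        ring
    rw [hτ, h, Complex.exp_add, Complex.exp_pi_mul_I]
    push_cast
    ring
  have h := EisensteinSeries.q_expansion_bernoulli (k := 6) (by norm_num) ⟨3, rfl⟩ τ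
  simp only [hq] at h
  rw [show E₆ τ = _ from h]
  norm_cast

end FaltingsApprox

end

/-! ### Size of the discriminant and the bounded remainder. -/

noncomputable section

namespace FaltingsApprox

open Derivative EisensteinSeries ModularForm MatrixGroups Filter Topology Manifold Metric
open scoped Real

/-- Finite products differ from `1` by at most `exp(∑ |q|ⁿ) - 1 ≤ exp(1/99) - 1 ≤ 1/98`. -/
theorem norm_tprod_one_sub_pow_sub_one_le {q : ℂ} (hq : ‖q‖ ≤ 1 / 100) :
    ‖∏' n : ℕ, (1 - q ^ (n + 1)) - 1‖ ≤ 1 / 50 := by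
  have hq1 : ‖q‖ < 1 := by linarith
  have hm := (multipliable_one_sub_pow hq1).hasProd
  have hs : Summable fun n : ℕ ↦ ‖q‖ ^ n * ‖q‖ :=
    (summable_geometric_of_lt_one (norm_nonneg _) hq1).mul_right _
  refine le_of_tendsto (hm.sub_const 1).norm (Eventually.of_forall fun s ↦ ?_)
  have h1 := Finset.norm_prod_one_add_sub_one_le s fun n : ℕ ↦ -q ^ (n + 1)
  simp only [← sub_eq_add_neg, norm_neg, pow_succ, norm_mul, norm_pow] at h1 ⊢
  refine h1.trans ?_
  have h2 : ∑ n ∈ s, ‖q‖ ^ n * ‖q‖ ≤ 1 / 99 := by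
    refine (hs.sum_le_tsum s fun _ _ ↦ by positivity).trans ?_
    rw [tsum_mul_right, tsum_geometric_of_lt_one (norm_nonneg _) hq1, ← div_eq_inv_mul,
      div_le_iff₀ (by linarith)]
    linarith
  have h3 : Real.exp (∑ n ∈ s, ‖q‖ ^ n * ‖q‖) ≤ Real.exp (1 / 99) := Real.exp_le_exp.mpr h2
  have h4 := Real.one_sub_le_exp_neg (1 / 99)
  have h5 : Real.exp (1 / 99) * Real.exp (-(1 / 99)) = 1 := by rw [← Real.exp_add]; simp
  have h6 := Real.exp_pos (1 / 99)
  nlinarith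

theorem norm_discriminant_eq (τ : ℍ) : ‖discriminant τ‖ =
    Real.exp (-(2 * π * τ.im)) *
      ‖∏' n : ℕ, (1 - Function.Periodic.qParam 1 (τ : ℂ) ^ (n + 1))‖ ^ 24 := by
  have hq : ‖Function.Periodic.qParam 1 (τ : ℂ)‖ = Real.exp (-(2 * π * τ.im)) := by
    simp [Function.Periodic.qParam, Complex.norm_exp]
  have hq1 : ‖Function.Periodic.qParam 1 (τ : ℂ)‖ < 1 :=
    Function.Periodic.norm_qParam_lt_one one_pos τ.im_pos
  rw [discriminant_eq_q_prod, norm_mul, hq, (multipliable_one_sub_pow hq1).tprod_pow, norm_pow]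

theorem exp_neg_le_of_three_le {y : ℝ} (hy : 0 < y) (h : 3 ≤ 4 * y ^ 2) :
    Real.exp (-(2 * π * y)) ≤ 1 / 100 := by
  have hy1 : 0.86 ≤ y := by nlinarith
  have hpi := Real.pi_gt_d2
  have h1 : Real.exp (-(2 * π * y)) ≤ Real.exp (-5) := Real.exp_le_exp.mpr (by nlinarith)
  refine h1.trans ?_
  have h2 : Real.exp 5 = Real.exp 1 ^ 5 := by rw [← Real.exp_nat_mul]; norm_num
  have h3 : (100 : ℝ) ≤ Real.exp 5 := by
    rw [h2]
    calc (100 : ℝ) ≤ 2.7 ^ 5 := by norm_num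
      _ ≤ Real.exp 1 ^ 5 := by
        gcongr
        linarith [Real.exp_one_gt_d9]
  rw [Real.exp_neg, one_div]
  exact inv_anti₀ (by norm_num) h3

theorem norm_discriminant_bounds {τ : ℍ} (h : 3 ≤ 4 * τ.im ^ 2) :
    Real.exp (-(2 * π * τ.im)) / 2 ≤ ‖discriminant τ‖ ∧
      ‖discriminant τ‖ ≤ 2 * Real.exp (-(2 * π * τ.im)) := by
  have hq : ‖Function.Periodic.qParam 1 (τ : ℂ)‖ ≤ 1 / 100 := by
    refine le_trans (le_of_eq ?_) (exp_neg_le_of_three_le τ.im_pos h)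
    simp [Function.Periodic.qParam, Complex.norm_exp]
  have hp := norm_tprod_one_sub_pow_sub_one_le hq
  rw [norm_discriminant_eq]
  set p := ∏' n : ℕ, (1 - Function.Periodic.qParam 1 (τ : ℂ) ^ (n + 1))
  have h1 : ‖p‖ ≤ 51 / 50 := by
    have := norm_sub_norm_le p 1
    rw [norm_one] at this
    linarith
  have h2 : 49 / 50 ≤ ‖p‖ := by
    have := norm_sub_norm_le 1 p
    rw [norm_one, norm_sub_rev] at this
    linarith
  have h3 : ‖p‖ ^ 24 ≤ 2 := (pow_le_pow_left₀ (norm_nonneg _) h1 24).trans (by norm_num)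
  have h4 : 1 / 2 ≤ ‖p‖ ^ 24 := le_trans (by norm_num) (pow_le_pow_left₀ (by norm_num) h2 24)
  have := Real.exp_pos (-(2 * π * τ.im))
  constructor <;> nlinarith

theorem im_pow_mul_norm_discriminant_smul (γ : SL(2, ℤ)) (τ : ℍ) :
    (γ • τ).im ^ 6 * ‖discriminant (γ • τ)‖ = τ.im ^ 6 * ‖discriminant τ‖ := by
  have h := congrFun (discriminant_slash γ) τ
  have hd : ‖denom (γ : GL (Fin 2) ℝ) τ‖ ≠ 0 := norm_ne_zero_iff.mpr (denom_ne_zero _ τ)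
  rw [ModularForm.SL_slash_apply, zpow_neg, zpow_ofNat] at h
  rw [← h, norm_mul, norm_inv, norm_pow, ModularGroup.im_smul_eq_div_normSq,
    Complex.normSq_eq_norm_sq]
  field_simp

/-- By invariance `τ` may be moved to the fundamental domain, where `|Δ| ≤ 2 exp(-2πy)`. The
inequality `y ≤ πy/3 ≤ exp(πy/3 - 1)`, raised to the sixth power, absorbs `y⁶`. -/
theorem im_pow_mul_norm_discriminant_le (τ : ℍ) :
    τ.im ^ 6 * ‖discriminant τ‖ ≤ 2 * Real.exp (-6) := by
  obtain ⟨γ, hγ⟩ := ModularGroup.exists_smul_mem_fd τ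
  rw [← im_pow_mul_norm_discriminant_smul γ]
  set σ := γ • τ
  have h1 := (norm_discriminant_bounds (ModularGroup.three_le_four_mul_im_sq_of_mem_fd hγ)).2
  have hy : 0 < σ.im := σ.im_pos
  have hle : σ.im ≤ Real.exp (π / 3 * σ.im - 1) := by
    have h2 := Real.add_one_le_exp (π / 3 * σ.im - 1)
    nlinarith [Real.pi_gt_three]
  have h3 : σ.im ^ 6 ≤ Real.exp (2 * π * σ.im) * Real.exp (-6) := by
    refine (pow_le_pow_left₀ hy.le hle 6).trans (le_of_eq ?_)
    rw [← Real.exp_nat_mul, ← Real.exp_add]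
    push_cast
    ring_nf
  calc σ.im ^ 6 * ‖discriminant σ‖
      ≤ Real.exp (2 * π * σ.im) * Real.exp (-6) * (2 * Real.exp (-(2 * π * σ.im))) := by gcongr
    _ = 2 * Real.exp (-6) * (Real.exp (2 * π * σ.im) * Real.exp (-(2 * π * σ.im))) := by ring
    _ = 2 * Real.exp (-6) := by rw [← Real.exp_add]; simp

/-- Here `(√3/2)⁶ = 27/64`, `π√3 ≤ 6`, and `27/128 ≥ 1/5`. -/
theorem im_pow_mul_norm_discriminant_rho_ge (τ : ℍ) (hτ : (τ : ℂ) = rho) :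
    Real.exp (-6) / 5 ≤ τ.im ^ 6 * ‖discriminant τ‖ := by
  have him : τ.im = Real.sqrt 3 / 2 := by
    rw [← coe_im, hτ]
    rfl
  have hs : Real.sqrt 3 ^ 2 = 3 := Real.sq_sqrt (by norm_num)
  have hs1 : Real.sqrt 3 ≤ 1.8 := by
    rw [Real.sqrt_le_left (by norm_num)]
    norm_num
  have h2 : τ.im ^ 2 = 3 / 4 := by rw [him, div_pow, hs]; norm_num
  have h6 : τ.im ^ 6 = 27 / 64 := by
    rw [show 6 = 2 * 3 by norm_num, pow_mul, h2]
    norm_num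
  have h1 := (norm_discriminant_bounds (τ := τ) (by rw [h2]; norm_num)).1
  have h3 : Real.exp (-6) ≤ Real.exp (-(2 * π * τ.im)) := by
    refine Real.exp_le_exp.mpr ?_
    rw [him]
    nlinarith [Real.pi_lt_d2, Real.pi_pos, Real.sqrt_nonneg 3]
  have h4 := Real.exp_pos (-6)
  rw [h6]
  linarith

theorem im_pow_mul_norm_discriminant_psi {w : ℂ} (hw : w ∈ ball (0 : ℂ) 1) :
    (ofComplex (psi w)).im ^ 6 * ‖discriminant (ofComplex (psi w))‖ =
      27 / 64 * (‖hHat w‖ * (1 - ‖w‖ ^ 2) ^ 6) := by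
  have hw1 : ‖1 + w‖ ≠ 0 := by
    rw [add_comm]
    exact norm_ne_zero_iff.mpr (one_add_ne_zero_of_mem_ball hw)
  have hs : Real.sqrt 3 ^ 6 = 27 := by
    rw [show 6 = 2 * 3 by norm_num, pow_mul, Real.sq_sqrt (by norm_num)]
    norm_num
  rw [← coe_im, coe_ofComplex_psi hw, psi_im, hHat, norm_div, norm_pow, mul_pow, div_pow, div_pow,
    hs]
  field_simp
  norm_num
  ring

/-- Comparison of the Petersson norm of `Δ` with its value at `ρ`, on the disc. -/
theorem norm_hHat_le {w : ℂ} (hw : w ∈ ball (0 : ℂ) 1) :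
    ‖hHat w‖ * (1 - ‖w‖ ^ 2) ^ 6 ≤ 10 * ‖hHat 0‖ := by
  have h0 : (0 : ℂ) ∈ ball (0 : ℂ) 1 := mem_ball_self one_pos
  have h1 := im_pow_mul_norm_discriminant_le (ofComplex (psi w))
  have h2 := im_pow_mul_norm_discriminant_rho_ge (ofComplex (psi 0))
    (by rw [coe_ofComplex_psi h0, psi_zero])
  rw [im_pow_mul_norm_discriminant_psi hw] at h1
  rw [im_pow_mul_norm_discriminant_psi h0] at h2
  simp only [norm_zero, ne_eq, OfNat.ofNat_ne_zero, not_false_eq_true, zero_pow, sub_zero, one_pow,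
    mul_one] at h2
  linarith

/-- On this disc `1 - |w|² ≥ 19/100`, and `10/(19/100)⁶ ≤ 2.7¹³ ≤ e¹³`. -/
theorem IsLogBranch.re_sub_le {L : ℂ → ℂ} (hL : IsLogBranch L) {w : ℂ} (hw : ‖w‖ ≤ 9 / 10) :
    (L w - L 0).re ≤ 13 := by
  have hw1 : w ∈ ball (0 : ℂ) 1 := by
    rw [mem_ball_zero_iff]
    linarith
  have h0 : (0 : ℂ) ∈ ball (0 : ℂ) 1 := mem_ball_self one_pos
  have h1 := norm_hHat_le hw1
  rw [← hL.2 w hw1, ← hL.2 0 h0, Complex.norm_exp, Complex.norm_exp] at h1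
  have h2 : (19 / 100 : ℝ) ^ 6 ≤ (1 - ‖w‖ ^ 2) ^ 6 :=
    pow_le_pow_left₀ (by norm_num) (by nlinarith [norm_nonneg w]) 6
  have h3 : Real.exp (L w).re * (19 / 100 : ℝ) ^ 6 ≤ 10 * Real.exp (L 0).re :=
    (mul_le_mul_of_nonneg_left h2 (Real.exp_pos _).le).trans h1
  have h4 : (10 : ℝ) / (19 / 100) ^ 6 ≤ Real.exp 13 := by
    have h5 : Real.exp 13 = Real.exp 1 ^ 13 := by rw [← Real.exp_nat_mul]; norm_num
    rw [h5]
    calc (10 : ℝ) / (19 / 100) ^ 6 ≤ 2.7 ^ 13 := by norm_num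
      _ ≤ Real.exp 1 ^ 13 := by
        gcongr
        linarith [Real.exp_one_gt_d9]
  rw [div_le_iff₀ (by norm_num)] at h4
  have h6 : Real.exp (L w).re ≤ Real.exp (13 + (L 0).re) := by
    rw [Real.exp_add]
    have := Real.exp_pos (L 0).re
    have h7 : (0 : ℝ) < (19 / 100) ^ 6 := by norm_num
    refine le_of_mul_le_mul_right ?_ h7
    nlinarith
  rw [Complex.sub_re]
  linarith [Real.exp_le_exp.mp h6]

/-- The expansion `L = L(0) + a w³ + w⁶ κ(w)` with a bounded remainder `κ`. -/
theorem IsLogBranch.exists_expansion {L : ℂ → ℂ} (hL : IsLogBranch L) :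
    ∃ (a : ℂ) (κ : ℂ → ℂ), DifferentiableOn ℂ κ (ball 0 (9 / 10)) ∧
      (∀ w ∈ ball (0 : ℂ) (9 / 10), L w = L 0 + a * w ^ 3 + w ^ 6 * κ w) ∧
      ∀ w : ℂ, ‖w‖ ≤ 2 / 5 → ‖κ w‖ ≤ 170 := by
  obtain ⟨Φ, hΦ, hLΦ⟩ := exists_differentiableOn_comp_cube rho_sq_primitive hL.1
    fun _ ↦ hL.rotate
  have hΦ0 : Φ 0 = L 0 := by simpa using (hLΦ 0 (mem_ball_self one_pos)).symm
  have hsub : ball (0 : ℂ) (729 / 1000) ⊆ ball 0 1 := ball_subset_ball (by norm_num)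
  -- The radius is `(9/10)³`, the image of `|w| < 9/10` under cubing.
  obtain ⟨a, χ, hχ, hexp, hb⟩ := exists_quadratic_remainder_of_re_le (Φ := fun z ↦ Φ z - L 0)
    (R := 729 / 1000) (A := 13) (by norm_num) (by norm_num) ((hΦ.mono hsub).sub_const _)
    (by simp [hΦ0]) (by
      intro z hz
      obtain ⟨w, rfl⟩ : ∃ w : ℂ, w ^ 3 = z := IsAlgClosed.exists_pow_nat_eq z (by norm_num)
      have hw : ‖w‖ < 9 / 10 := by
        rw [mem_ball_zero_iff, norm_pow] at hz
        refine lt_of_pow_lt_pow_left₀ 3 (by norm_num) (hz.trans_le (by norm_num))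
      have hw1 : w ∈ ball (0 : ℂ) 1 := by
        rw [mem_ball_zero_iff]
        linarith
      rw [← hLΦ w hw1]
      exact hL.re_sub_le hw.le)
  have hcube {w : ℂ} (hw : w ∈ ball (0 : ℂ) (9 / 10)) : w ^ 3 ∈ ball (0 : ℂ) (729 / 1000) := by
    rw [mem_ball_zero_iff] at hw ⊢
    rw [norm_pow]
    exact (pow_lt_pow_left₀ hw (norm_nonneg _) (by norm_num)).trans_le (by norm_num)
  refine ⟨a, fun w ↦ χ (w ^ 3), ?_, ?_, ?_⟩
  · exact hχ.comp (by fun_prop) fun w hw ↦ hcube hw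
  · intro w hw
    have h1 := hexp _ (hcube hw)
    rw [hLΦ w (ball_subset_ball (by norm_num) hw)]
    linear_combination h1
  · intro w hw
    have hz : ‖w ^ 3‖ ≤ 8 / 125 := by
      rw [norm_pow]
      exact (pow_le_pow_left₀ (norm_nonneg _) hw 3).trans (by norm_num)
    -- Numerically, `6 · 13 / (0.729 · (0.729 - 0.064))` is about `161`.
    refine (hb _ (hcube (mem_ball_zero_iff.mpr (by linarith)))).trans ?_
    rw [div_le_iff₀ (by nlinarith)]
    nlinarith

end FaltingsApprox

end

/-! ### The cubic coefficient and the Green function on the disc. -/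

noncomputable section

namespace FaltingsApprox

open Derivative EisensteinSeries ModularForm MatrixGroups Filter Topology Manifold Metric
open scoped Real

/-- `Δ = η²⁴`, and the logarithmic derivative of `η` is a multiple of `E2`. -/
theorem normalizedDeriv_discriminant (τ : ℍ) :
    normalizedDerivOfComplex discriminant τ = E2 τ * discriminant τ := by
  have hη := differentiableAt_eta_of_mem_upperHalfPlaneSet τ.2
  have heq : discriminant ∘ ofComplex =ᶠ[𝓝 (τ : ℂ)] fun z ↦ eta z ^ 24 := by
    filter_upwards [isOpen_upperHalfPlaneSet.mem_nhds τ.im_pos] with z hz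
    simp [discriminant, ofComplex_apply_of_im_pos hz]
  have hl := logDeriv_eta_eq_E2 τ
  have hη0 := eta_ne_zero τ.2
  rw [logDeriv_apply, div_eq_iff hη0] at hl
  have hd : HasDerivAt (discriminant ∘ ofComplex) _ (τ : ℂ) :=
    (hη.hasDerivAt.pow 24).congr_of_eventuallyEq heq
  have hpi : (π : ℂ) ≠ 0 := by exact_mod_cast Real.pi_ne_zero
  have hI : Complex.I ≠ 0 := Complex.I_ne_zero
  rw [normalizedDerivOfComplex, hd.deriv, hl, discriminant]
  field_simp
  push_cast
  norm_num
  ring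

theorem IsLogBranch.deriv_eq {L : ℂ → ℂ} (hL : IsLogBranch L) {w : ℂ}
    (hw : w ∈ ball (0 : ℂ) 1) :
    deriv L w = discScale * (E2 (ofComplex (psi w)) / (1 + w) ^ 2) - 12 / (1 + w) := by
  have h1 : 1 + w ≠ 0 := by
    rw [add_comm]
    exact one_add_ne_zero_of_mem_ball hw
  have hd := (hL.1.differentiableAt (isOpen_ball.mem_nhds hw)).hasDerivAt.cexp
  have hh := hasDerivAt_comp_psi_div mdifferentiable_discriminant 12 hw
  have heq : (fun w ↦ Complex.exp (L w)) =ᶠ[𝓝 w] hHat := by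
    filter_upwards [isOpen_ball.mem_nhds hw] with x hx using hL.2 x hx
  have h := (hh.congr_of_eventuallyEq heq).unique hd
  have hΔ := discriminant_ne_zero (ofComplex (psi w))
  rw [hL.2 w hw, normalizedDeriv_discriminant, hHat] at h
  refine mul_left_cancel₀ (div_ne_zero hΔ (pow_ne_zero 12 h1)) (h.symm.trans ?_)
  push_cast
  field_simp

/-- Ramanujan's differential equation for `E₂`, transported to the disc. -/
theorem IsLogBranch.deriv_deriv_eq {L : ℂ → ℂ} (hL : IsLogBranch L) {w : ℂ}
    (hw : w ∈ ball (0 : ℂ) 1) :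
    discScale ^ 2 * (E₄ (ofComplex (psi w)) / (1 + w) ^ 4) =
      deriv L w ^ 2 - 12 * deriv (deriv L) w := by
  have h1 : 1 + w ≠ 0 := by
    rw [add_comm]
    exact one_add_ne_zero_of_mem_ball hw
  have hE := (hasDerivAt_comp_psi_div E2_mdifferentiable 2 hw).const_mul (discScale : ℂ)
  have hi : HasDerivAt (fun w : ℂ ↦ 12 / (1 + w)) (12 * (-1 / (1 + w) ^ 2)) w := by
    have := (((hasDerivAt_id w).const_add 1).inv h1).const_mul 12
    simpa [div_eq_mul_inv] using this
  have heq : deriv L =ᶠ[𝓝 w]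
      fun w ↦ discScale * (E2 (ofComplex (psi w)) / (1 + w) ^ 2) - 12 / (1 + w) := by
    filter_upwards [isOpen_ball.mem_nhds hw] with x hx using hL.deriv_eq hx
  rw [((hE.sub hi).congr_of_eventuallyEq heq).deriv, hL.deriv_eq hw, normalizedDeriv_E2]
  field_simp
  push_cast
  ring

/-- The first two derivatives of `c + a w³ + w⁶ κ(w)`. -/
theorem derivs_of_expansion {L κ : ℂ → ℂ} {a c : ℂ} {r : ℝ}
    (hκ : DifferentiableOn ℂ κ (ball 0 r))
    (hL : ∀ w ∈ ball (0 : ℂ) r, L w = c + a * w ^ 3 + w ^ 6 * κ w) {w : ℂ}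
    (hw : w ∈ ball (0 : ℂ) r) :
    deriv L w = 3 * a * w ^ 2 + w ^ 5 * (6 * κ w + w * deriv κ w) ∧
      deriv (deriv L) w = 6 * a * w +
        w ^ 4 * (30 * κ w + 12 * w * deriv κ w + w ^ 2 * deriv (deriv κ) w) := by
  have hκ1 (x : ℂ) (hx : x ∈ ball (0 : ℂ) r) : HasDerivAt κ (deriv κ x) x :=
    (hκ.differentiableAt (isOpen_ball.mem_nhds hx)).hasDerivAt
  have hκ2 (x : ℂ) (hx : x ∈ ball (0 : ℂ) r) : HasDerivAt (deriv κ) (deriv (deriv κ) x) x :=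
    ((hκ.deriv isOpen_ball).differentiableAt (isOpen_ball.mem_nhds hx)).hasDerivAt
  have hp (n : ℕ) (x : ℂ) : HasDerivAt (fun x : ℂ ↦ x ^ n) (n * x ^ (n - 1)) x := hasDerivAt_pow n x
  have h1 (x : ℂ) (hx : x ∈ ball (0 : ℂ) r) :
      deriv L x = 3 * a * x ^ 2 + x ^ 5 * (6 * κ x + x * deriv κ x) := by
    have heq : L =ᶠ[𝓝 x] fun w ↦ c + a * w ^ 3 + w ^ 6 * κ w := by
      filter_upwards [isOpen_ball.mem_nhds hx] with y hy using hL y hy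
    have hd := (((hp 3 x).const_mul a).const_add c).add ((hp 6 x).mul (hκ1 x hx))
    rw [(hd.congr_of_eventuallyEq heq).deriv]
    push_cast
    ring
  refine ⟨h1 w hw, ?_⟩
  have heq : deriv L =ᶠ[𝓝 w] fun x ↦ 3 * a * x ^ 2 + x ^ 5 * (6 * κ x + x * deriv κ x) := by
    filter_upwards [isOpen_ball.mem_nhds hw] with y hy using h1 y hy
  have hd := ((hp 2 w).const_mul (3 * a)).add ((hp 5 w).mul
    (((hκ1 w hw).const_mul 6).add ((hasDerivAt_id w).mul (hκ2 w hw))))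
  rw [(hd.congr_of_eventuallyEq heq).deriv]
  simp only [Pi.add_apply, Pi.mul_apply, id]
  push_cast
  ring

/-- The cubic coefficient of `log ĥ` in terms of `E₆(ρ)` and of `f'(0)`. -/
theorem cubic_coefficient_eq {f L κ : ℂ → ℂ} {a : ℂ} {r : ℝ} (hr : 0 < r) (hr1 : r ≤ 1)
    (hf : IsCubicFactor f) (hL : IsLogBranch L) (hκ : DifferentiableOn ℂ κ (ball 0 r))
    (hexp : ∀ w ∈ ball (0 : ℂ) r, L w = L 0 + a * w ^ 3 + w ^ 6 * κ w) :
    216 * a = discScale ^ 3 * E₆ (ofComplex (psi 0)) ∧ deriv f 0 = 13824 * a := by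
  have hk : (discScale : ℂ) ≠ 0 := by exact_mod_cast discScale_pos.ne'
  have h0 : (0 : ℂ) ∈ ball (0 : ℂ) 1 := mem_ball_self one_pos
  have h0r : (0 : ℂ) ∈ ball (0 : ℂ) r := mem_ball_self hr
  set τ : ℍ := ofComplex (psi 0)
  -- The quotient of `(L'² - 12 L'')/k²` by `w`, written out from the expansion so that it makes
  -- sense at `0`.
  let ε : ℂ → ℂ := fun w ↦ (w ^ 3 * (3 * a + w ^ 3 * (6 * κ w + w * deriv κ w)) ^ 2 -
    12 * (6 * a + w ^ 3 * (30 * κ w + 12 * w * deriv κ w + w ^ 2 * deriv (deriv κ) w))) /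
      discScale ^ 2
  have hκd : DifferentiableAt ℂ κ 0 := hκ.differentiableAt (isOpen_ball.mem_nhds h0r)
  have hκd1 : DifferentiableAt ℂ (deriv κ) 0 :=
    (hκ.deriv isOpen_ball).differentiableAt (isOpen_ball.mem_nhds h0r)
  have hκd2 : DifferentiableAt ℂ (deriv (deriv κ)) 0 :=
    ((hκ.deriv isOpen_ball).deriv isOpen_ball).differentiableAt (isOpen_ball.mem_nhds h0r)
  have hε : DifferentiableAt ℂ ε 0 := by
    simp only [ε]
    fun_prop
  have hε0 : ε 0 = -72 * a / discScale ^ 2 := by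
    simp [ε]
    ring
  have he4 : ∀ w ∈ ball (0 : ℂ) r, E₄ (ofComplex (psi w)) / (1 + w) ^ 4 = w * ε w := by
    intro w hw
    have h := hL.deriv_deriv_eq (ball_subset_ball hr1 hw)
    obtain ⟨h1, h2⟩ := derivs_of_expansion hκ hexp hw
    rw [h1, h2] at h
    refine mul_left_cancel₀ (pow_ne_zero 2 hk) (h.trans ?_)
    simp only [ε]
    field_simp
  have hE4 : E₄ τ = 0 := by simpa using he4 0 h0r
  -- The derivative of `w ε(w)` at `0`, computed a second time from the equation for `E₄`; all terms
  -- containing `E₄(ρ) = 0` drop out.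
  have hder : ε 0 = -discScale * E₆ τ / 3 := by
    have hA := hasDerivAt_comp_psi_div (ModularFormClass.holo E₄) 4 h0
    have hB : HasDerivAt (fun w ↦ w * ε w) (1 * ε 0 + 0 * deriv ε 0) 0 :=
      (hasDerivAt_id (0 : ℂ)).mul hε.hasDerivAt
    have heq : (fun w ↦ E₄ (ofComplex (psi w)) / (1 + w) ^ 4) =ᶠ[𝓝 0] fun w ↦ w * ε w := by
      filter_upwards [isOpen_ball.mem_nhds h0r] with w hw using he4 w hw
    have h := (hB.congr_of_eventuallyEq heq).unique hA
    have hD := normalizedDeriv_E4 τ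
    rw [hE4] at hD
    change _ = discScale * normalizedDerivOfComplex E₄ τ / _ - _ * E₄ τ / _ at h
    rw [hD, hE4] at h
    simp only [add_zero, one_pow, div_one] at h
    linear_combination h
  have ha : 216 * a = discScale ^ 3 * E₆ τ := by
    rw [hε0] at hder
    field_simp at hder
    linear_combination -hder
  refine ⟨ha, ?_⟩
  have hΔ : discriminant τ = -E₆ τ ^ 2 / 1728 := by
    rw [discriminant_eq_E₄_cube_sub_E₆_sq, hE4]
    ring
  have hE6 : E₆ τ ≠ 0 := by
    intro h
    apply discriminant_ne_zero τ
    rw [hΔ, h]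
    simp
  have hf0 : f 0 = 0 := by
    have h := hf.2 0 h0
    rw [jDisc, jInv] at h
    change E₄ τ ^ 3 / _ = _ at h
    rw [hE4] at h
    simpa using h.symm
  have hjs : ∀ w ∈ ball (0 : ℂ) r, f (w ^ 3) = (w * ε w) ^ 3 / hHat w := by
    intro w hw
    have h1 : 1 + w ≠ 0 := by
      rw [add_comm]
      exact one_add_ne_zero_of_mem_ball (ball_subset_ball hr1 hw)
    rw [← hf.2 w (ball_subset_ball hr1 hw), ← he4 w hw, jDisc, jInv, hHat]
    have := discriminant_ne_zero (ofComplex (psi w))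
    field_simp
  -- The difference quotient of `f` at `0` is sampled at `w³`, where it equals `ε(w)³/ĥ(w)`.
  have hlim1 : Tendsto (fun w : ℂ ↦ slope f 0 (w ^ 3)) (𝓝[≠] 0) (𝓝 (deriv f 0)) := by
    have hs := ((hf.1.differentiableAt (isOpen_ball.mem_nhds h0)).hasDerivAt).tendsto_slope
    refine hs.comp (tendsto_nhdsWithin_iff.mpr ⟨?_, ?_⟩)
    · have : Tendsto (fun w : ℂ ↦ w ^ 3) (𝓝 0) (𝓝 (0 ^ 3)) := (continuous_pow 3).tendsto 0
      rw [zero_pow (by norm_num)] at this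
      exact this.mono_left nhdsWithin_le_nhds
    · filter_upwards [self_mem_nhdsWithin] with w hw
      exact pow_ne_zero 3 hw
  have hlim2 : Tendsto (fun w : ℂ ↦ slope f 0 (w ^ 3)) (𝓝[≠] 0) (𝓝 (ε 0 ^ 3 / hHat 0)) := by
    have hh : ContinuousAt hHat 0 :=
      (differentiableOn_hHat.differentiableAt (isOpen_ball.mem_nhds h0)).continuousAt
    have hc : Tendsto (fun w ↦ ε w ^ 3 / hHat w) (𝓝 0) (𝓝 (ε 0 ^ 3 / hHat 0)) :=
      (hε.continuousAt.pow 3).div hh (hHat_ne_zero h0)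
    refine (hc.mono_left nhdsWithin_le_nhds).congr' ?_
    filter_upwards [self_mem_nhdsWithin, mem_nhdsWithin_of_mem_nhds (isOpen_ball.mem_nhds h0r)]
      with w hw hwr
    have hw0 : w ≠ 0 := hw
    have := hHat_ne_zero (ball_subset_ball hr1 hwr)
    rw [slope_def_field, hf0, hjs w hwr]
    field_simp
    ring
  rw [tendsto_nhds_unique hlim1 hlim2, hder]
  have hh0 : hHat 0 = discriminant τ := by simp [hHat, τ]
  rw [hh0, hΔ]
  field_simp
  linear_combination (-1728 : ℂ) * ha

theorem IsLogBranch.gDisc_eq {L : ℂ → ℂ} (hL : IsLogBranch L) {w : ℂ}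
    (hw : w ∈ ball (0 : ℂ) 1) :
    gDisc w = -Real.log ((4 * π) ^ 6 * (27 / 64)) - (L w).re - 6 * Real.log (1 - ‖w‖ ^ 2) := by
  have hpos : 0 < 1 - ‖w‖ ^ 2 := by
    rw [mem_ball_zero_iff] at hw
    nlinarith [norm_nonneg w]
  rw [gDisc, gInfty, mul_pow, mul_assoc, im_pow_mul_norm_discriminant_psi hw, ← mul_assoc,
    ← hL.2 w hw, Complex.norm_exp, Real.log_mul (by positivity) (by positivity),
    Real.log_mul (by positivity) (by positivity),
    Real.log_mul (by positivity) (by positivity), Real.log_exp,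
    Real.log_pow, Real.log_pow]
  push_cast
  ring

theorem radius_le : 1 - Real.pi / (2 * Real.sqrt 3) ≤ 1 / 10 := by
  have h3 : Real.sqrt 3 ≤ 1.74 := by
    rw [Real.sqrt_le_left (by norm_num)]
    norm_num
  have hpos : 0 < Real.sqrt 3 := by positivity
  have : 9 / 10 ≤ Real.pi / (2 * Real.sqrt 3) := by
    rw [le_div_iff₀ (by positivity)]
    nlinarith [Real.pi_gt_d2]
  linarith

end FaltingsApprox

end

/-! ### Assembly: Cauchy estimates and final constants. -/

open FaltingsApprox Metric

theorem mainTheorem8 :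
    (∃ f : ℂ → ℂ, FaltingsApprox.IsCubicFactor f) ∧
    (∃ L : ℂ → ℂ, FaltingsApprox.IsLogBranch L) ∧
    ∀ f L : ℂ → ℂ, FaltingsApprox.IsCubicFactor f → FaltingsApprox.IsLogBranch L →
      (deriv f 0).im = 0 ∧
      ∀ w ∈ Metric.ball (0 : ℂ) 1, ‖w‖ ≤ 1 - Real.pi / (2 * Real.sqrt 3) →
        |FaltingsApprox.gDisc w -
            (FaltingsApprox.gDisc 0 - 6 * Real.log (1 - ‖w‖ ^ 2)
              - (deriv f 0).re / 13824 * (w ^ 3).re)| ≤ 6 ^ 3 * ‖w‖ ^ 6 ∧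
        ‖deriv L w * w - 3 * deriv f 0 / 13824 * w ^ 3‖ ≤ 6 ^ 4 * ‖w‖ ^ 6 ∧
        ‖deriv (deriv L) w * w ^ 2 - 6 * deriv f 0 / 13824 * w ^ 3‖ ≤ 5 * 6 ^ 4 * ‖w‖ ^ 6 := by
  refine ⟨exists_isCubicFactor, exists_isLogBranch, fun f L hf hL ↦ ?_⟩
  obtain ⟨a, κ, hκ, hexp, hb⟩ := hL.exists_expansion
  obtain ⟨ha, hfa⟩ := cubic_coefficient_eq (by norm_num) (by norm_num) hf hL hκ hexp
  have h0 : (0 : ℂ) ∈ ball (0 : ℂ) 1 := mem_ball_self one_pos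
  have haim : a.im = 0 := by
    have h6 := im_E6_rho (UpperHalfPlane.ofComplex (psi 0)) (by rw [coe_ofComplex_psi h0, psi_zero])
    have h := congrArg Complex.im ha
    rw [← Complex.ofReal_pow, Complex.im_ofReal_mul, h6] at h
    simpa using h
  refine ⟨by rw [hfa]; simp [haim], fun w hw1 hwr ↦ ?_⟩
  have hw : ‖w‖ ≤ 1 / 10 := hwr.trans radius_le
  have hwb : w ∈ ball (0 : ℂ) (9 / 10) := mem_ball_zero_iff.mpr (by linarith)
  obtain ⟨hd1, hd2⟩ := derivs_of_expansion hκ hexp hwb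
  -- Since `1/10 + 3/10 = 2/5`, Cauchy circles of radius `3/10` stay where `|κ| ≤ 170`; they give
  -- `170/0.3 < 567` and `2 · 170/0.09 < 3800`.
  have hnear : ∀ z ∈ closedBall w (3 / 10), ‖z‖ ≤ 2 / 5 := by
    intro z hz
    rw [mem_closedBall, dist_eq_norm] at hz
    have := norm_le_norm_add_norm_sub' z w
    linarith
  have hdc : DiffContOnCl ℂ κ (ball w (3 / 10)) := by
    refine DifferentiableOn.diffContOnCl (hκ.mono fun z hz ↦ ?_)
    rw [closure_ball _ (by norm_num)] at hz
    exact mem_ball_zero_iff.mpr ((hnear z hz).trans_lt (by norm_num))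
  have hκ0 : ‖κ w‖ ≤ 170 := hb w (by linarith)
  have hs : ∀ z ∈ sphere w (3 / 10), ‖κ z‖ ≤ 170 := fun z hz ↦
    hb z (hnear z (sphere_subset_closedBall hz))
  have hκ1 : ‖deriv κ w‖ ≤ 567 :=
    (Complex.norm_deriv_le_of_forall_mem_sphere_norm_le (by norm_num) hdc hs).trans (by norm_num)
  have hκ2 : ‖deriv (deriv κ) w‖ ≤ 3800 := by
    have := Complex.norm_iteratedDeriv_le_of_forall_mem_sphere_norm_le 2 (by norm_num) hdc hs
    rw [iteratedDeriv_succ, iteratedDeriv_one] at this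
    exact this.trans (by norm_num [Nat.factorial])
  have hn := norm_nonneg w
  have e1 : ‖w * deriv κ w‖ ≤ 57 := by
    rw [norm_mul]
    nlinarith [norm_nonneg (deriv κ w)]
  have e2 : ‖w ^ 2 * deriv (deriv κ) w‖ ≤ 38 := by
    rw [norm_mul, norm_pow]
    have : ‖w‖ ^ 2 ≤ 1 / 100 := by nlinarith
    nlinarith [norm_nonneg (deriv (deriv κ) w)]
  -- The constants close as `170 ≤ 6³`, `6 · 170 + 57 = 1077 ≤ 6⁴` and `30 · 170 + 12 · 57 + 38 =
  -- 5822 ≤ 5 · 6⁴`.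
  refine ⟨?_, ?_, ?_⟩
  · have hre : gDisc w - (gDisc 0 - 6 * Real.log (1 - ‖w‖ ^ 2)
        - (deriv f 0).re / 13824 * (w ^ 3).re) = -(w ^ 6 * κ w).re := by
      have hre : (L w).re = (L 0).re + a.re * (w ^ 3).re + (w ^ 6 * κ w).re := by
        rw [hexp w hwb, Complex.add_re, Complex.add_re, Complex.mul_re a, haim, zero_mul, sub_zero]
      have hfre : (deriv f 0).re = 13824 * a.re := by rw [hfa]; simp
      rw [hL.gDisc_eq hw1, hL.gDisc_eq h0, hre, hfre]
      simp
      ring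
    rw [hre, abs_neg]
    refine (Complex.abs_re_le_norm _).trans ?_
    rw [norm_mul, norm_pow, mul_comm]
    gcongr
    linarith
  · have h : deriv L w * w - 3 * deriv f 0 / 13824 * w ^ 3 =
        (6 * κ w + w * deriv κ w) * w ^ 6 := by
      rw [hd1, hfa]
      ring
    rw [h, norm_mul, norm_pow]
    gcongr
    refine (norm_add_le _ _).trans ?_
    rw [norm_mul, Complex.norm_ofNat]
    linarith
  · have h : deriv (deriv L) w * w ^ 2 - 6 * deriv f 0 / 13824 * w ^ 3 =
        (30 * κ w + 12 * (w * deriv κ w) + w ^ 2 * deriv (deriv κ) w) * w ^ 6 := by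
      rw [hd2, hfa]
      ring
    rw [h, norm_mul, norm_pow]
    gcongr
    refine (norm_add₃_le).trans ?_
    rw [norm_mul, norm_mul, Complex.norm_ofNat, Complex.norm_ofNat]
    linarith
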